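/- Let $\gamma>1$, and let either $0<\alpha\le\frac12$ and $\bar\rho\ge0$, or $\alpha>\frac12$ and $\bar\rho>0$. Consider on $\mathbb R$ the Cauchy problem $$\rho_t+(\rho u)_x=0,\qquad (\rho u)_t+(\rho u^2+\rho^\gamma)_x=(\rho^\alpha u_x)_x,\qquad (\rho,\rho u)|_{t=0}=(\rho_0,m_0).$$ Write $E(r)=\frac1{\gamma-1}\big(r^\gamma-\bar\rho^\gamma-\gamma\bar\rho^{\gamma-1}(r-\bar\rho)\big)$, and $\eta(r)=r^{\alpha-1/2}$, $c=\frac{2\alpha}{2\alpha-1}$ if $\alpha\ne\frac12$, $\eta(r)=\log r$, $c=\frac12$ if $\alpha=\frac12$. All derivatives in $x$ of functions of $\rho$, $\rho_0$ are weak derivatives. Assume that $\rho_0\ge0$, with $\rho_0>0$ a.e. if $\alpha\le\frac12$; that $E(\rho_0)\in L^1(\mathbb R)$ if $\bar\rho>0$ and $\rho_0\in L^1(\mathbb R)$ if $\bar\rho=0$; that $\eta(\rho_0)_x\in L^2(\mathbb R)$; and that $|m_0|^2/\rho_0$ and $|m_0|^{2+\delta}/\rho_0^{1+\delta}$ are in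 $L^1(\mathbb R)$ for some $0<\delta<1$ (so $m_0=0$ a.e. where $\rho_0=0$). For $T>0$ put $$\langle\rho^\alpha u_x,\varphi\rangle_T=-\int_0^T\!\!\int_{\mathbb R}\rho^{\alpha-1/2}\sqrt\rho\,u\,\varphi_x\,dx\,dt-c\int_0^T\!\!\int_{\mathbb R}\eta(\rho)_x\sqrt\rho\,u\,\varphi\,dx\,dt .$$ A pair $(\rho,u)$ is a weak solution on $\mathbb R\times(0,T)$ if $\rho\ge0$ a.e. ($\rho>0$ a.e. if $\alpha\le\frac12$); $\rho-\bar\rho\in L^\infty(0,T;L^\infty)$, $E(\rho)\in L^\infty(0,T;L^1)$, and $\sqrt\rho u,\ \eta(\rho)_x\in L^\infty(0,T;L^2)$; $\rho(\cdot,0)=\rho_0$; for all $0\le t_1\le t_2\le T$ and all compactly supported $\zeta\in C^1$, $$\int_{\mathbb R}\rho\zeta\,dx\Big|_{t_1}^{t_2}=\int_{t_1}^{t_2}\!\!\int_{\mathbb R}(\rho\zeta_t+\rho u\zeta_x)\,dx\,dt;$$ and for all $\psi\in C_c^\infty(\mathbb R\times[0,T))$, $$\int_{\mathbb R}m_0\psi(\cdot,0)\,dx+\int_0^T\!\!\int_{\mathbb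 R}\big[\sqrt\rho(\sqrt\rho u)\psi_t+((\sqrt\rho u)^2+\rho^\gamma)\psi_x\big]dx\,dt-\langle\rho^\alpha u_x,\psi_x\rangle_T=0 .$$ Let $(\rho,u)$ be a weak solution on $\mathbb R\times(0,T)$ for every $T>0$, and suppose that there is a constant $C$, independent of $T$, such that for every $T>0$: 1. $\rho\in C(\mathbb R\times(0,T))$ and $\rho\ge0$ there; 2. $\sup_t\int_{\mathbb R}|\rho-\bar\rho|^2dx+\sup\rho\le C$ if $\bar\rho>0$, and $\sup_t\int_{\mathbb R}\rho\,dx+\sup\rho\le C$ if $\bar\rho=0$; 3. there is $\Lambda\in L^2(\mathbb R\times(0,T))$ with $\int_0^T\!\int_{\mathbb R}\Lambda\psi\,dx\,dt=\langle\rho^\alpha u_x,\psi\rangle_T$ for all $\psi\in C_c^\infty(\mathbb R\times(0,T))$, and $$\sup_t\int_{\mathbb R}\big(|\sqrt\rho u|^2+(\eta(\rho)_x)^2+E(\rho)\big)dx+\int_0^T\!\!\int_{\mathbb R}\Big(\big[(\rho^{\frac{\gamma+\alpha-1}2})_x\big]^2+\Lambda^2\Big)dx\,dt\le C,$$ the suprema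 being over (almost every) $t\in(0,T)$. Then $$\lim_{t\to\infty}\ \sup_{x\in\mathbb R}|\rho(x,t)-\bar\rho|=0 .$$ -/

import Mathlib

open MeasureTheory Filter Topology Set
open scoped ENNReal NNReal ContDiff

namespace CNS

noncomputable section

/-!
Functions of space and time are curried, `f x t`, with space variable first.
Test functions are functions `ψ : ℝ × ℝ → ℝ` of the pair `(x, t)`.
-/

/-- The space-time measure on `ℝ × (0, T)`. -/
def slab (T : ℝ) : Measure (ℝ × ℝ) :=
  volume.restrict (univ ×ˢ Ioo 0 T)

/-- The time measure on `(0, T)`. -/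
def timeMeasure (T : ℝ) : Measure ℝ :=
  volume.restrict (Ioo 0 T)

/-- Partial derivative in `x` of a function of the pair `(x, t)`. -/
def dx (ψ : ℝ × ℝ → ℝ) (z : ℝ × ℝ) : ℝ := deriv (fun y => ψ (y, z.2)) z.1

/-- Partial derivative in `t` of a function of the pair `(x, t)`. -/
def dt (ψ : ℝ × ℝ → ℝ) (z : ℝ × ℝ) : ℝ := deriv (fun s => ψ (z.1, s)) z.2

/-- `G` is the weak derivative of `F` on the real line (both locally integrable). -/
def HasWeakDeriv (F G : ℝ → ℝ) : Prop :=
  LocallyIntegrable F ∧ LocallyIntegrable G ∧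
    ∀ φ : ℝ → ℝ, ContDiff ℝ ∞ φ → HasCompactSupport φ →
      ∫ x, F x * deriv φ x = -∫ x, G x * φ x

/-- `g` is measurable on `ℝ × (0, T)` and is the weak derivative in space of `f`
at almost every time of `(0, T)`. -/
def HasWeakDerivX (T : ℝ) (f g : ℝ → ℝ → ℝ) : Prop :=
  AEStronglyMeasurable (fun z : ℝ × ℝ => g z.1 z.2) (slab T) ∧
    ∀ᵐ t ∂timeMeasure T, HasWeakDeriv (fun x => f x t) (fun x => g x t)

/-- `f ∈ L^∞(0, T; L^p(ℝ))`. -/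
def MemLinftyLp (T : ℝ) (p : ℝ≥0∞) (f : ℝ → ℝ → ℝ) : Prop :=
  AEStronglyMeasurable (fun z : ℝ × ℝ => f z.1 z.2) (slab T) ∧
    ∃ M : ℝ≥0, ∀ᵐ t ∂timeMeasure T, eLpNorm (fun x => f x t) p volume ≤ M

/-- The supremum over the times of `(0, T)`, up to null sets of times. -/
def supTime (T : ℝ) (F : ℝ → ℝ≥0∞) : ℝ≥0∞ := essSup F (timeMeasure T)

/-- The potential energy density
`ρ Ψ(ρ, ρ̄) = (ρ^γ - ρ̄^γ - γ ρ̄^(γ-1) (ρ - ρ̄)) / (γ - 1)`,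
where `Ψ(ρ, ρ̄) = ∫_ρ̄^ρ (s^γ - ρ̄^γ) / s² ds`; this form also makes sense at `ρ = 0`. -/
def potential (γ ρbar r : ℝ) : ℝ :=
  1 / (γ - 1) * (r ^ γ - ρbar ^ γ - γ * ρbar ^ (γ - 1) * (r - ρbar))

/-- The function of the density whose `x`-derivative is controlled:
`ρ^(α - 1/2)` if `α ≠ 1/2`, and `log ρ` if `α = 1/2`. -/
def entropyVar (α r : ℝ) : ℝ :=
  if α = 1 / 2 then Real.log r else r ^ (α - 1 / 2)

/-- The coefficient of the second term in the weak form of `ρ^α u_x`. -/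
def diffCoeff (α : ℝ) : ℝ :=
  if α = 1 / 2 then 1 / 2 else 2 * α / (2 * α - 1)

/-- The weak form `⟨ρ^α u_x, φ⟩` of the diffusion term on `ℝ × (0, T)`, with `g` standing for
`(ρ^(α - 1/2))_x`, or for `(log ρ)_x` if `α = 1/2`:
`- ∫∫ ρ^(α-1/2) √ρ u φ_x - c ∫∫ g √ρ u φ`, with `c = diffCoeff α`. -/
def diffusion (α T : ℝ) (ρ u g : ℝ → ℝ → ℝ) (φ : ℝ × ℝ → ℝ) : ℝ :=
  -(∫ t in (0 : ℝ)..T, ∫ x, (ρ x t) ^ (α - 1 / 2) * (√(ρ x t) * u x t) * dx φ (x, t))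
    - diffCoeff α * ∫ t in (0 : ℝ)..T, ∫ x, g x t * (√(ρ x t) * u x t) * φ (x, t)

/-- The assumptions on the initial density `ρ0`, the initial momentum `m0` and the far-field
density `ρbar`. -/
structure InitialData (α γ ρbar : ℝ) (ρ0 m0 : ℝ → ℝ) : Prop where
  meas_density : AEStronglyMeasurable ρ0
  meas_momentum : AEStronglyMeasurable m0
  pos : α ≤ 1 / 2 → ∀ᵐ x, 0 < ρ0 x
  nonneg : ∀ᵐ x, 0 ≤ ρ0 x
  potential_int : 0 < ρbar → Integrable (fun x => potential γ ρbar (ρ0 x))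
  mass_int : ρbar = 0 → Integrable ρ0
  entropy : ∃ g0 : ℝ → ℝ, HasWeakDeriv (fun x => entropyVar α (ρ0 x)) g0 ∧ MemLp g0 2
  /-- The quotients below are understood to be infinite where `ρ0 = 0` and `m0 ≠ 0`. -/
  momentum_vacuum : ∀ᵐ x, ρ0 x = 0 → m0 x = 0
  kinetic : Integrable (fun x => |m0 x| ^ 2 / ρ0 x)
  kinetic_higher : ∃ δ : ℝ, 0 < δ ∧ δ < 1 ∧
    Integrable (fun x => |m0 x| ^ (2 + δ) / (ρ0 x) ^ (1 + δ))

/-- `(ρ, u)` is a weak solution on `ℝ × (0, T)` of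
`ρ_t + (ρ u)_x = 0`, `(ρ u)_t + (ρ u² + ρ^γ)_x = (ρ^α u_x)_x`
with initial data `(ρ, ρ u) = (ρ0, m0)` at `t = 0` and far-field density `ρbar`. -/
structure IsWeakSolution (α γ ρbar : ℝ) (ρ0 m0 : ℝ → ℝ) (T : ℝ) (ρ u : ℝ → ℝ → ℝ) : Prop where
  nonneg : ∀ᵐ z ∂slab T, 0 ≤ ρ z.1 z.2
  /-- `ρ^(α - 1/2)`, or `log ρ`, is finite almost everywhere when `α ≤ 1/2`. -/
  pos : α ≤ 1 / 2 → ∀ᵐ z ∂slab T, 0 < ρ z.1 z.2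
  density_bdd : MemLinftyLp T ∞ (fun x t => ρ x t - ρbar)
  potential_int : MemLinftyLp T 1 (fun x t => potential γ ρbar (ρ x t))
  kinetic : MemLinftyLp T 2 (fun x t => √(ρ x t) * u x t)
  initial : ∀ᵐ x, ρ x 0 = ρ0 x
  mass : ∀ t₁ t₂ : ℝ, 0 ≤ t₁ → t₁ ≤ t₂ → t₂ ≤ T →
    ∀ ζ : ℝ × ℝ → ℝ, ContDiff ℝ 1 ζ → HasCompactSupport ζ →
      (∫ x, ρ x t₂ * ζ (x, t₂)) - (∫ x, ρ x t₁ * ζ (x, t₁)) =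
        ∫ t in t₁..t₂, ∫ x, (ρ x t * dt ζ (x, t) + ρ x t * u x t * dx ζ (x, t))
  /-- The weak derivative of `ρ^(α - 1/2)` (of `log ρ` if `α = 1/2`) is in `L^∞(0, T; L²)`, and
  the momentum equation holds. -/
  momentum : ∃ g : ℝ → ℝ → ℝ,
    HasWeakDerivX T (fun x t => entropyVar α (ρ x t)) g ∧ MemLinftyLp T 2 g ∧
    ∀ ψ : ℝ × ℝ → ℝ, ContDiff ℝ ∞ ψ → HasCompactSupport ψ → tsupport ψ ⊆ univ ×ˢ Iio T →
      (∫ x, m0 x * ψ (x, 0))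
        + (∫ t in (0 : ℝ)..T, ∫ x, (√(ρ x t) * (√(ρ x t) * u x t) * dt ψ (x, t)
            + ((√(ρ x t) * u x t) ^ 2 + (ρ x t) ^ γ) * dx ψ (x, t)))
        - diffusion α T ρ u g (dx ψ) = 0

/-- The regularity and the bounds, with constant `C`, on `ℝ × (0, T)`. -/
structure EntropyBounds (α γ ρbar : ℝ) (C : ℝ≥0) (T : ℝ) (ρ u : ℝ → ℝ → ℝ) : Prop where
  continuous : ContinuousOn (fun z : ℝ × ℝ => ρ z.1 z.2) (univ ×ˢ Ioo 0 T)
  nonneg : ∀ x, ∀ t ∈ Ioo 0 T, 0 ≤ ρ x t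
  density_of_pos : 0 < ρbar →
    supTime T (fun t => ∫⁻ x, ENNReal.ofReal (|ρ x t - ρbar| ^ 2))
      + supTime T (fun t => ⨆ x, ENNReal.ofReal (ρ x t)) ≤ C
  density_of_zero : ρbar = 0 →
    supTime T (fun t => ∫⁻ x, ENNReal.ofReal (ρ x t))
      + supTime T (fun t => ⨆ x, ENNReal.ofReal (ρ x t)) ≤ C
  /-- Here `g` is `(ρ^(α - 1/2))_x` (or `(log ρ)_x`), `h` is `(ρ^((γ + α - 1)/2))_x`, and `Λ` is
  the weak form of `ρ^α u_x`. -/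
  entropy : ∃ g h : ℝ → ℝ → ℝ, ∃ Λ : ℝ × ℝ → ℝ,
    HasWeakDerivX T (fun x t => entropyVar α (ρ x t)) g ∧
    HasWeakDerivX T (fun x t => (ρ x t) ^ ((γ + α - 1) / 2)) h ∧
    MemLp Λ 2 (slab T) ∧
    (∀ ψ : ℝ × ℝ → ℝ, ContDiff ℝ ∞ ψ → HasCompactSupport ψ → tsupport ψ ⊆ univ ×ˢ Ioo 0 T →
      ∫ t in (0 : ℝ)..T, ∫ x, Λ (x, t) * ψ (x, t) = diffusion α T ρ u g ψ) ∧
    supTime T (fun t => ∫⁻ x, ENNReal.ofReal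
        (|√(ρ x t) * u x t| ^ 2 + (g x t) ^ 2 + potential γ ρbar (ρ x t)))
      + ∫⁻ t in Ioo 0 T, ∫⁻ x, ENNReal.ofReal ((h x t) ^ 2 + (Λ (x, t)) ^ 2) ≤ C

end

end CNS

namespace CNS

/-! The proof is by contradiction: the total dissipation is at most `C` however long the time
interval, whereas recurring deviations of size `ε` would each cost a fixed amount of it.

A deviation persists. The bound on `entropyVar α ρ` in the homogeneous H¹ seminorm makes the density
uniformly continuous in space, uniformly in time (`exists_space_modulus`). By the mass equation and
the kinetic energy bound, its local averages are Lipschitz in time (`exists_time_lipschitz`). Hence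
a deviation above `ε` leaves one above `ε / 4` during a time `τ` that does not depend on when or
where it occurs (`exists_persistence`).

A deviation costs dissipation. The integrability of `ρ`, or of `|ρ - ρbar| ^ 2`, brings the density
near `ρbar` within a bounded distance of any point, so `ρ ^ ((γ + α - 1) / 2)` changes by a fixed
amount over a bounded length, and its derivative has square integral at least `c`
(`exists_dissipation`).

Deviations at arbitrarily late times would give more than `C / (c * τ)` disjoint windows, hence
dissipation above `C`. -/

/-! ### Quantitative injectivity and positivity of functions of the density -/

theorem exists_rpow_gap {β ε : ℝ} (hβ : 0 < β) (hε : 0 < ε) (M : ℝ) :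
    ∃ κ : ℝ, 0 < κ ∧ ∀ a ∈ Icc 0 M, ∀ b ∈ Icc 0 M, ε ≤ |a - b| → κ ≤ |a ^ β - b ^ β| := by
  -- On this compact set of separated pairs the power gap is continuous, and nonzero by injectivity;
  -- its minimum serves as `κ`.
  let S : Set (ℝ × ℝ) := (Icc 0 M ×ˢ Icc 0 M) ∩ {p | ε ≤ |p.1 - p.2|}
  have hS : IsCompact S := (isCompact_Icc.prod isCompact_Icc).inter_right
    (isClosed_le continuous_const (by fun_prop))
  have hcont : Continuous fun p : ℝ × ℝ => |p.1 ^ β - p.2 ^ β| :=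
    (((Real.continuous_rpow_const hβ.le).comp continuous_fst).sub
      ((Real.continuous_rpow_const hβ.le).comp continuous_snd)).abs
  rcases S.eq_empty_or_nonempty with hempty | hne
  · refine ⟨1, one_pos, fun a ha b hb hab => ?_⟩
    have : (a, b) ∈ S := ⟨⟨ha, hb⟩, hab⟩
    simp [hempty] at this
  · obtain ⟨p, ⟨⟨hp1, hp2⟩, hp⟩, hmin⟩ := hS.exists_isMinOn hne hcont.continuousOn
    refine ⟨_, abs_pos.2 (sub_ne_zero.2 fun h => ?_), fun a ha b hb hab =>
      hmin (show (a, b) ∈ S from ⟨⟨ha, hb⟩, hab⟩)⟩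
    have := (Real.rpow_left_inj hp1.1 hp2.1 hβ.ne').1 h
    simp only [mem_ofPred_eq, this, sub_self, abs_zero] at hp
    linarith

/-- This turns an oscillation bound for `entropyVar α ρ` into one for `ρ`. For `α < 1 / 2` the
function is the reciprocal of a positive power, and the upper bound `M` controls the denominators;
for the logarithm, `log t ≤ t - 1` suffices. -/
theorem exists_entropyVar_gap (α : ℝ) {ε M : ℝ} (hε : 0 < ε) (hM : 0 < M) :
    ∃ κ : ℝ, 0 < κ ∧ ∀ a ∈ Icc 0 M, ∀ b ∈ Icc 0 M, (α ≤ 1 / 2 → 0 < a) → (α ≤ 1 / 2 → 0 < b) →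
      ε ≤ |a - b| → κ ≤ |entropyVar α a - entropyVar α b| := by
  rcases lt_trichotomy α (1 / 2) with h | h | h
  · obtain ⟨κ, hκ, H⟩ := exists_rpow_gap (sub_pos.2 h) hε M
    refine ⟨κ / (M ^ (1 / 2 - α) * M ^ (1 / 2 - α)), by positivity,
      fun a ha b hb ha0 hb0 hab => ?_⟩
    have ha1 := ha0 h.le
    have hb1 := hb0 h.le
    have hpa : 0 < a ^ (1 / 2 - α) := by positivity
    have hpb : 0 < b ^ (1 / 2 - α) := by positivity
    have key : entropyVar α a - entropyVar α b =
        -(a ^ (1 / 2 - α) - b ^ (1 / 2 - α)) / (a ^ (1 / 2 - α) * b ^ (1 / 2 - α)) := by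
      rw [entropyVar, if_neg h.ne, entropyVar, if_neg h.ne,
        show α - 1 / 2 = -(1 / 2 - α) by ring, Real.rpow_neg ha.1, Real.rpow_neg hb.1]
      field_simp
      ring
    rw [key, abs_div, abs_neg, abs_of_pos (mul_pos hpa hpb)]
    have hβ : 0 ≤ 1 / 2 - α := by linarith
    gcongr
    · exact H a ha b hb hab
    · exact ha.2
    · exact hb.2
  · refine ⟨ε / M, by positivity, fun a ha b hb ha0 hb0 hab => ?_⟩
    have ha1 := ha0 h.le
    have hb1 := hb0 h.le
    have key : ∀ x y : ℝ, 0 < x → 0 < y → x ≤ M → ε ≤ x - y → ε / M ≤ Real.log x - Real.log y := by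
      intro x y hx hy hxM hxy
      have h1 := Real.log_le_sub_one_of_pos (div_pos hy hx)
      rw [Real.log_div hy.ne' hx.ne'] at h1
      have h2 : ε / M ≤ (x - y) / x := by
        have : 0 ≤ x - y := by linarith
        gcongr
      have h3 : (x - y) / x = 1 - y / x := by field_simp
      linarith
    rw [entropyVar, if_pos h, entropyVar, if_pos h]
    rcases le_abs.1 hab with h1 | h1
    · exact (key a b ha1 hb1 ha.2 h1).trans (le_abs_self _)
    · rw [abs_sub_comm]
      exact (key b a hb1 ha1 hb.2 (by linarith)).trans (le_abs_self _)
  · obtain ⟨κ, hκ, H⟩ := exists_rpow_gap (sub_pos.2 h) hε M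
    refine ⟨κ, hκ, fun a ha b hb _ _ hab => ?_⟩
    rw [entropyVar, if_neg h.ne', entropyVar, if_neg h.ne']
    exact H a ha b hb hab

/-- Convexity of the power, in the form of Bernoulli's inequality at `r / ρbar`. -/
theorem potential_nonneg {γ ρbar r : ℝ} (hγ : 1 < γ) (hρ : 0 ≤ ρbar) (hr : 0 ≤ r) :
    0 ≤ potential γ ρbar r := by
  have hγ' : 0 < γ - 1 := by linarith
  refine mul_nonneg (by positivity) ?_
  rcases hρ.eq_or_lt with rfl | hρ
  · rw [Real.zero_rpow (by linarith), Real.zero_rpow hγ'.ne']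
    have := Real.rpow_nonneg hr γ
    linarith
  · have h := one_add_mul_self_le_rpow_one_add (s := r / ρbar - 1) (by
      have : 0 ≤ r / ρbar := by positivity
      linarith) hγ.le
    rw [add_sub_cancel, Real.div_rpow hr hρ.le] at h
    have hp : 0 < ρbar ^ γ := by positivity
    have h2 := mul_le_mul_of_nonneg_right h hp.le
    rw [div_mul_cancel₀ _ hp.ne'] at h2
    rw [Real.rpow_sub_one hρ.ne']
    have : γ * (ρbar ^ γ / ρbar) * (r - ρbar) = γ * (r / ρbar - 1) * ρbar ^ γ := by
      field_simp
    nlinarith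

/-! ### Mollifiers and oscillation bounds from weak derivatives -/

theorem exists_mollifier {r : ℝ} (hr : 0 < r) :
    ∃ b : ℝ → ℝ, ContDiff ℝ ∞ b ∧ HasCompactSupport b ∧ (∀ z, 0 ≤ b z) ∧ ∫ z, b z = 1 ∧
      ∀ z, r ≤ |z| → b z = 0 := by
  let f : ContDiffBump (0 : ℝ) := ⟨r / 2, r, by positivity, by linarith⟩
  refine ⟨f.normed volume, f.contDiff_normed, f.hasCompactSupport_normed,
    fun z => f.nonneg_normed z, f.integral_normed, fun z hz => ?_⟩
  by_contra h
  have : z ∈ Function.support (f.normed volume) := h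
  rw [f.support_normed_eq] at this
  simp only [Metric.mem_ball, dist_zero_right, Real.norm_eq_abs] at this
  exact absurd this (not_lt.2 hz)

/-- Averaging against a mollifier stays close to a value from which the function stays close. -/
theorem abs_integral_mul_mollifier_sub_le {F b : ℝ → ℝ} {r x c ε : ℝ}
    (hF : LocallyIntegrable F) (hb : Continuous b) (hbs : HasCompactSupport b)
    (hb0 : ∀ z, 0 ≤ b z) (hb1 : ∫ z, b z = 1) (hbr : ∀ z, r ≤ |z| → b z = 0)
    (h : ∀ z, |z - x| < r → |F z - c| ≤ ε) :
    |(∫ z, F z * b (z - x)) - c| ≤ ε := by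
  have hbx : Continuous fun z => b (z - x) := by fun_prop
  have hbxs : HasCompactSupport fun z => b (z - x) := 
    hbs.comp_homeomorph (Homeomorph.subRight x)
  have hi : Integrable fun z => b (z - x) := hbx.integrable_of_hasCompactSupport hbxs
  have hFi : Integrable fun z => F z * b (z - x) := by
    simpa [mul_comm] using hF.integrable_smul_right_of_hasCompactSupport hbx hbxs
  have hone : ∫ z, b (z - x) = 1 := by rw [integral_sub_right_eq_self (fun z => b z), hb1]
  have e1 : (∫ z, F z * b (z - x)) - c = ∫ z, (F z - c) * b (z - x) := by
    simp_rw [sub_mul]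
    rw [integral_sub hFi (hi.const_mul c), integral_const_mul, hone, mul_one]
  have e2 : ε = ∫ z, ε * b (z - x) := by rw [integral_const_mul, hone, mul_one]
  rw [e1, e2, ← Real.norm_eq_abs]
  refine norm_integral_le_of_norm_le (hi.const_mul ε) (ae_of_all _ fun z => ?_)
  rw [norm_mul, Real.norm_eq_abs, Real.norm_eq_abs, abs_of_nonneg (hb0 _)]
  rcases lt_or_ge |z - x| r with hz | hz
  · exact mul_le_mul_of_nonneg_right (h z hz) (hb0 _)
  · simp [hbr _ hz]

/-- Young's inequality for the integral of a product. -/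
theorem abs_integral_mul_le {f g : ℝ → ℝ} {K J δ : ℝ} (hK : 0 ≤ K) (hJ : 0 ≤ J) (hδ : 0 < δ)
    (hg : Measurable g) (hf2 : ∫⁻ x, ENNReal.ofReal (f x ^ 2) ≤ ENNReal.ofReal K)
    (hg2 : ∫⁻ x, ENNReal.ofReal (g x ^ 2) ≤ ENNReal.ofReal J) :
    |∫ x, f x * g x| ≤ δ / 2 * K + J / (2 * δ) := by
  have hle : ‖∫ x, f x * g x‖ₑ ≤ ENNReal.ofReal (δ / 2 * K + J / (2 * δ)) := by
    calc ‖∫ x, f x * g x‖ₑ ≤ ∫⁻ x, ‖f x * g x‖ₑ := enorm_integral_le_lintegral_enorm _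
      _ ≤ ∫⁻ x, (ENNReal.ofReal (δ / 2) * ENNReal.ofReal (f x ^ 2)
            + ENNReal.ofReal (1 / (2 * δ)) * ENNReal.ofReal (g x ^ 2)) := by
          refine lintegral_mono fun x => ?_
          rw [← ENNReal.ofReal_mul (by positivity), ← ENNReal.ofReal_mul (by positivity),
            ← ENNReal.ofReal_add (by positivity) (by positivity), ← ofReal_norm]
          refine ENNReal.ofReal_le_ofReal ?_
          rw [norm_mul, Real.norm_eq_abs, Real.norm_eq_abs, ← sq_abs (f x), ← sq_abs (g x)]
          have : δ / 2 * |f x| ^ 2 + 1 / (2 * δ) * |g x| ^ 2 - |f x| * |g x| =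
              (δ * |f x| - |g x|) ^ 2 / (2 * δ) := by
            field_simp
            ring
          have h2 : 0 ≤ (δ * |f x| - |g x|) ^ 2 / (2 * δ) := by positivity
          linarith
      _ = ENNReal.ofReal (δ / 2) * (∫⁻ x, ENNReal.ofReal (f x ^ 2))
            + ENNReal.ofReal (1 / (2 * δ)) * ∫⁻ x, ENNReal.ofReal (g x ^ 2) := by
          rw [lintegral_add_right _ (by fun_prop), lintegral_const_mul' _ _ ENNReal.ofReal_ne_top,
            lintegral_const_mul' _ _ ENNReal.ofReal_ne_top]
      _ ≤ ENNReal.ofReal (δ / 2) * ENNReal.ofReal K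
            + ENNReal.ofReal (1 / (2 * δ)) * ENNReal.ofReal J := by gcongr
      _ = ENNReal.ofReal (δ / 2 * K + J / (2 * δ)) := by
          rw [← ENNReal.ofReal_mul (by positivity), ← ENNReal.ofReal_mul (by positivity),
            ← ENNReal.ofReal_add (by positivity) (by positivity)]
          congr 1
          ring
  rw [← ofReal_norm, ENNReal.ofReal_le_ofReal_iff (by positivity)] at hle
  exact hle

/-- A function with square integrable weak derivative oscillates little between points of
continuity. -/
theorem HasWeakDeriv.abs_sub_le_of_le {F G : ℝ → ℝ} {K δ x y : ℝ} (hFG : HasWeakDeriv F G)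
    (hK : 0 ≤ K) (hδ : 0 < δ) (hG : ∫⁻ z, ENNReal.ofReal (G z ^ 2) ≤ ENNReal.ofReal K)
    (hx : ContinuousAt F x) (hy : ContinuousAt F y) (hxy : x ≤ y) :
    |F y - F x| ≤ δ / 2 * K + (y - x) / (2 * δ) := by
  obtain ⟨hF, -, htest⟩ := hFG
  refine le_of_forall_pos_le_add fun ε hε => ?_
  obtain ⟨rx, hrx, Hx⟩ := Metric.continuousAt_iff.1 hx (ε / 3) (by positivity)
  obtain ⟨ry, hry, Hy⟩ := Metric.continuousAt_iff.1 hy (ε / 3) (by positivity)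
  -- The bound `δ * ε / 3` makes the excess length `2 * r` of the support of the test function cost
  -- at most `ε / 3`.
  set r := min (min rx ry) (δ * ε / 3) with hr
  have hr0 : 0 < r := by positivity
  obtain ⟨b, hbC, hbs, hb0, hb1, hbr⟩ := exists_mollifier hr0
  have hbi : Integrable b := hbC.continuous.integrable_of_hasCompactSupport hbs
  have hbii : ∀ p q, IntervalIntegrable b volume p q := fun p q => hbi.intervalIntegrable
  -- A smoothed indicator of `[x, y]`: its derivative is the difference of the mollifiers at `x` and
  -- `y`, so testing with it compares the averages of `F` there.
  let φ : ℝ → ℝ := fun z => ∫ s in (z - y)..(z - x), b s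
  have hderiv : ∀ z, HasDerivAt φ (b (z - x) - b (z - y)) z := by
    intro z
    have h1 : ∀ p : ℝ, HasDerivAt (fun z => ∫ s in (0 : ℝ)..(z - p), b s) (b (z - p)) z := by
      intro p
      have := (hbC.continuous.integral_hasStrictDerivAt 0 (z - p)).hasDerivAt
      exact this.comp_sub_const z p
    have h2 := (h1 x).sub (h1 y)
    refine h2.congr_of_eventuallyEq (Eventually.of_forall fun w => ?_)
    exact (intervalIntegral.integral_interval_sub_left (hbii _ _) (hbii _ _)).symm
  have hderiv' : deriv φ = fun z => b (z - x) - b (z - y) := funext fun z => (hderiv z).deriv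
  have hφC : ContDiff ℝ ∞ φ := by
    rw [contDiff_infty_iff_deriv]
    refine ⟨fun z => (hderiv z).differentiableAt, ?_⟩
    rw [hderiv']
    fun_prop
  have hφz : ∀ z, z ∉ Icc (x - r) (y + r) → φ z = 0 := by
    intro z hz
    refine (intervalIntegral.integral_congr (g := fun _ => 0) fun s hs => ?_).trans (by simp)
    rw [uIcc_of_le (by linarith)] at hs
    apply hbr
    rw [mem_Icc, not_and_or, not_le, not_le] at hz
    rcases hz with hz | hz
    · exact le_abs.2 (Or.inr (by linarith [hs.2]))
    · exact le_abs.2 (Or.inl (by linarith [hs.1]))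
  have hφs : HasCompactSupport φ := HasCompactSupport.intro isCompact_Icc hφz
  have hφ0 : ∀ z, 0 ≤ φ z := fun z =>
    intervalIntegral.integral_nonneg (by linarith) fun s _ => hb0 s
  have hφ1 : ∀ z, φ z ≤ 1 := fun z => by
    rw [← hb1]
    show ∫ s in (z - y)..(z - x), b s ≤ _
    rw [intervalIntegral.integral_of_le (by linarith)]
    exact setIntegral_le_integral hbi (ae_of_all _ hb0)
  have hφ2 : ∫⁻ z, ENNReal.ofReal (φ z ^ 2) ≤ ENNReal.ofReal (y - x + 2 * r) := by
    calc ∫⁻ z, ENNReal.ofReal (φ z ^ 2)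
        ≤ ∫⁻ z, (Icc (x - r) (y + r)).indicator (fun _ => 1) z := by
          refine lintegral_mono fun z => ?_
          by_cases hz : z ∈ Icc (x - r) (y + r)
          · rw [indicator_of_mem hz, ← ENNReal.ofReal_one]
            exact ENNReal.ofReal_le_ofReal (pow_le_one₀ (hφ0 z) (hφ1 z))
          · simp [hφz z hz]
      _ = ENNReal.ofReal (y - x + 2 * r) := by
          rw [lintegral_indicator measurableSet_Icc]
          simp only [lintegral_const, Measure.restrict_apply, MeasurableSet.univ, univ_inter,
            one_mul, Real.volume_Icc]
          congr 1
          ring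
  have hmain := abs_integral_mul_le hK (by linarith) hδ hφC.continuous.measurable hG hφ2
  have htr : ∀ p, Integrable fun z => F z * b (z - p) := by
    intro p
    have hbp : HasCompactSupport fun z => b (z - p) := hbs.comp_homeomorph (Homeomorph.subRight p)
    simpa [mul_comm] using hF.integrable_smul_right_of_hasCompactSupport
      (hbC.continuous.comp (continuous_id.sub continuous_const)) hbp
  have heq : (∫ z, F z * b (z - x)) - ∫ z, F z * b (z - y) = -∫ z, G z * φ z := by
    rw [← htest φ hφC hφs, hderiv', ← integral_sub (htr x) (htr y)]
    simp_rw [mul_sub]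
  have hrx' : r ≤ rx := (min_le_left _ _).trans (min_le_left _ _)
  have hry' : r ≤ ry := (min_le_left _ _).trans (min_le_right _ _)
  have hrδ : r ≤ δ * ε / 3 := min_le_right _ _
  have hax := abs_integral_mul_mollifier_sub_le hF hbC.continuous hbs hb0 hb1 hbr
    (x := x) (c := F x) fun z hz => (Hx (hz.trans_le hrx')).le
  have hay := abs_integral_mul_mollifier_sub_le hF hbC.continuous hbs hb0 hb1 hbr
    (x := y) (c := F y) fun z hz => (Hy (hz.trans_le hry')).le
  have hJ : (y - x + 2 * r) / (2 * δ) ≤ (y - x) / (2 * δ) + ε / 3 := by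
    have h1 : (y - x + 2 * r) / (2 * δ) = (y - x) / (2 * δ) + r / δ := by field_simp
    have h2 : r / δ ≤ ε / 3 := by
      rw [div_le_iff₀ hδ]
      linarith
    linarith
  rw [abs_le] at hax hay hmain ⊢
  constructor <;> linarith [hax.1, hax.2, hay.1, hay.2, hmain.1, hmain.2]

theorem HasWeakDeriv.abs_sub_le {F G : ℝ → ℝ} {K δ x y : ℝ} (hFG : HasWeakDeriv F G)
    (hK : 0 ≤ K) (hδ : 0 < δ) (hG : ∫⁻ z, ENNReal.ofReal (G z ^ 2) ≤ ENNReal.ofReal K)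
    (hx : ContinuousAt F x) (hy : ContinuousAt F y) :
    |F y - F x| ≤ δ / 2 * K + |y - x| / (2 * δ) := by
  rcases le_total x y with h | h
  · rw [abs_of_nonneg (sub_nonneg.2 h)]
    exact hFG.abs_sub_le_of_le hK hδ hG hx hy h
  · rw [abs_sub_comm, abs_sub_comm y, abs_of_nonneg (sub_nonneg.2 h)]
    exact hFG.abs_sub_le_of_le hK hδ hG hy hx h

/-! ### From almost every point to every point, and from integrals to points -/

theorem forall_le_of_ae_le {f : ℝ → ℝ} {U : Set ℝ} {c : ℝ} (hU : IsOpen U)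
    (hf : ContinuousOn f U) (h : ∀ᵐ t ∂volume.restrict U, f t ≤ c) : ∀ t ∈ U, f t ≤ c := by
  have : EqOn (fun t => max (f t) c) (fun _ => c) U :=
    Measure.eqOn_open_of_ae_eq (μ := volume) (h.mono fun t ht => max_eq_right ht) hU
      (hf.sup continuousOn_const) continuousOn_const
  exact fun t ht => max_eq_right_iff.1 (this ht)

/-- Chebyshev's argument: `f > η` on an interval of length `(C + 1) / η` would force an integral of
at least `C + 1`. -/
theorem exists_le_of_lintegral_le {f : ℝ → ℝ} {C η : ℝ} (hC : 0 ≤ C) (hη : 0 < η)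
    (hf : ∫⁻ x, ENNReal.ofReal (f x) ≤ ENNReal.ofReal C) (x : ℝ) :
    ∃ y, |y - x| ≤ (C + 1) / η ∧ f y ≤ η := by
  by_contra! H
  have hL : 0 < (C + 1) / η := by positivity
  have : ENNReal.ofReal (C + 1) ≤ ENNReal.ofReal C := by
    calc ENNReal.ofReal (C + 1)
        = ∫⁻ _ in Icc x (x + (C + 1) / η), ENNReal.ofReal η := by
          rw [lintegral_const, Measure.restrict_apply MeasurableSet.univ, univ_inter,
            Real.volume_Icc, ← ENNReal.ofReal_mul hη.le, add_sub_cancel_left,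
            mul_div_cancel₀ _ hη.ne']
      _ ≤ ∫⁻ y in Icc x (x + (C + 1) / η), ENNReal.ofReal (f y) := by
          refine setLIntegral_mono' measurableSet_Icc fun y hy => ENNReal.ofReal_le_ofReal ?_
          refine (H y ?_).le
          rw [abs_of_nonneg (by linarith [hy.1])]
          linarith [hy.2]
      _ ≤ ∫⁻ y, ENNReal.ofReal (f y) := setLIntegral_le_lintegral _ _
      _ ≤ _ := hf
  rw [ENNReal.ofReal_le_ofReal_iff hC] at this
  linarith

theorem ae_le_of_supTime_le {T : ℝ} {F : ℝ → ℝ≥0∞} {c : ℝ≥0∞} (h : supTime T F ≤ c) :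
    ∀ᵐ t ∂timeMeasure T, F t ≤ c :=
  (ENNReal.ae_le_essSup F).mono fun _ ht => ht.trans h

theorem ae_timeMeasure_mem (T : ℝ) : ∀ᵐ t ∂timeMeasure T, t ∈ Ioo 0 T :=
  ae_restrict_mem measurableSet_Ioo

theorem ae_time_of_ae_slab {T : ℝ} {p : ℝ × ℝ → Prop} (h : ∀ᵐ z ∂slab T, p z) :
    ∀ᵐ t ∂timeMeasure T, ∀ᵐ x, p (x, t) := by
  rw [slab, Measure.volume_eq_prod, ← Measure.prod_restrict, Measure.restrict_univ,
    ← Measure.prod_swap] at h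
  exact Measure.ae_ae_of_ae_prod (ae_of_ae_map measurable_swap.aemeasurable h)

/-! ### Consequences of the entropy bounds at fixed times -/

variable {α γ ρbar : ℝ} {ρ0 m0 : ℝ → ℝ} {ρ u : ℝ → ℝ → ℝ} {C : ℝ≥0} {T ε : ℝ}

theorem EntropyBounds.continuous_space (hb : EntropyBounds α γ ρbar C T ρ u) {t : ℝ}
    (ht : t ∈ Ioo 0 T) : Continuous fun x => ρ x t :=
  hb.continuous.comp_continuous (Continuous.prodMk_left t) fun x => ⟨mem_univ x, ht⟩

theorem EntropyBounds.continuousOn_time (hb : EntropyBounds α γ ρbar C T ρ u) (x : ℝ) :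
    ContinuousOn (fun t => ρ x t) (Ioo 0 T) :=
  hb.continuous.comp (Continuous.prodMk_right x).continuousOn fun _ ht => ⟨mem_univ x, ht⟩

theorem EntropyBounds.density_le (hb : EntropyBounds α γ ρbar C T ρ u) (hρbar : 0 ≤ ρbar)
    {t : ℝ} (ht : t ∈ Ioo 0 T) (x : ℝ) : ρ x t ≤ C := by
  have h : supTime T (fun t => ⨆ x, ENNReal.ofReal (ρ x t)) ≤ C := by
    rcases hρbar.eq_or_lt with h0 | h0
    · exact le_add_self.trans (hb.density_of_zero h0.symm)
    · exact le_add_self.trans (hb.density_of_pos h0)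
  refine forall_le_of_ae_le isOpen_Ioo (hb.continuousOn_time x) ?_ t ht
  filter_upwards [ae_le_of_supTime_le h] with s hs
  have := (le_iSup (fun x => ENNReal.ofReal (ρ x s)) x).trans hs
  rwa [← ENNReal.ofReal_coe_nnreal, ENNReal.ofReal_le_ofReal_iff C.coe_nonneg] at this

/-- At almost every time, the density comes close to its far-field value within a bounded distance
of any point. -/
theorem exists_density_near (hρbar : 0 ≤ ρbar)
    (hb : ∀ T : ℝ, 0 < T → EntropyBounds α γ ρbar C T ρ u) (hε : 0 < ε) :
    ∃ L : ℝ, 0 < L ∧ ∀ T : ℝ, 0 < T → ∀ᵐ t ∂timeMeasure T,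
      ∀ x, ∃ y, |y - x| ≤ L ∧ |ρ y t - ρbar| ≤ ε := by
  have hC := C.coe_nonneg
  rcases hρbar.eq_or_lt with h0 | h0
  · refine ⟨(C + 1) / ε, by positivity, fun T hT => ?_⟩
    filter_upwards [ae_le_of_supTime_le (le_self_add.trans ((hb T hT).density_of_zero h0.symm)),
      ae_timeMeasure_mem T] with t ht htT x
    rw [← ENNReal.ofReal_coe_nnreal] at ht
    obtain ⟨y, hy, hy'⟩ := exists_le_of_lintegral_le C.coe_nonneg hε ht x
    refine ⟨y, hy, ?_⟩
    rwa [← h0, sub_zero, abs_of_nonneg ((hb T hT).nonneg y t htT)]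
  · refine ⟨(C + 1) / ε ^ 2, by positivity, fun T hT => ?_⟩
    filter_upwards [ae_le_of_supTime_le (le_self_add.trans ((hb T hT).density_of_pos h0))]
      with t ht x
    rw [← ENNReal.ofReal_coe_nnreal] at ht
    obtain ⟨y, hy, hy'⟩ := exists_le_of_lintegral_le C.coe_nonneg (by positivity : 0 < ε ^ 2) ht x
    exact ⟨y, hy, le_of_sq_le_sq hy' hε.le⟩

/-- The hypothesis bounds only the sum of three terms; since the potential is nonnegative, each
square is bounded separately. -/
theorem EntropyBounds.ae_energy (hγ : 1 < γ) (hρbar : 0 ≤ ρbar)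
    (hb : EntropyBounds α γ ρbar C T ρ u) :
    ∀ᵐ t ∂timeMeasure T, (∫⁻ x, ENNReal.ofReal ((√(ρ x t) * u x t) ^ 2) ≤ ENNReal.ofReal C) ∧
      ∃ G : ℝ → ℝ, HasWeakDeriv (fun x => entropyVar α (ρ x t)) G ∧
        ∫⁻ x, ENNReal.ofReal (G x ^ 2) ≤ ENNReal.ofReal C := by
  obtain ⟨g, h, Λ, hg, -, -, -, hbd⟩ := hb.entropy
  filter_upwards [ae_le_of_supTime_le (le_self_add.trans hbd), ae_timeMeasure_mem T, hg.2]
    with t ht htT hgt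
  rw [ENNReal.ofReal_coe_nnreal]
  have hp : ∀ x, 0 ≤ potential γ ρbar (ρ x t) := fun x =>
    potential_nonneg hγ hρbar (hb.nonneg x t htT)
  refine ⟨(lintegral_mono fun x => ENNReal.ofReal_le_ofReal ?_).trans ht,
    fun x => g x t, hgt, (lintegral_mono fun x => ENNReal.ofReal_le_ofReal ?_).trans ht⟩
  · have := hp x
    rw [sq_abs]
    linarith [sq_nonneg (g x t)]
  · have := hp x
    linarith [sq_nonneg |√(ρ x t) * u x t|]

theorem continuousAt_entropyVar {r : ℝ} (hr : α ≤ 1 / 2 → 0 < r) :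
    ContinuousAt (entropyVar α) r := by
  by_cases h : α = 1 / 2
  · have : entropyVar α = Real.log := funext fun r => if_pos h
    rw [this]
    exact Real.continuousAt_log (hr h.le).ne'
  · have : entropyVar α = fun r => r ^ (α - 1 / 2) := funext fun r => if_neg h
    rw [this]
    refine Real.continuousAt_rpow_const _ _ ?_
    rcases lt_or_gt_of_ne h with h | h
    · exact Or.inl (hr h.le).ne'
    · exact Or.inr (by linarith)

/-! ### Space and time regularity of the density -/

/-- The density is uniformly continuous in space, uniformly in time. -/
theorem exists_space_modulus (hγ : 1 < γ) (hρbar : 0 ≤ ρbar)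
    (hsol : ∀ T : ℝ, 0 < T → IsWeakSolution α γ ρbar ρ0 m0 T ρ u)
    (hb : ∀ T : ℝ, 0 < T → EntropyBounds α γ ρbar C T ρ u) (hε : 0 < ε) :
    ∃ r : ℝ, 0 < r ∧ ∀ t, 0 < t → ∀ x y, |y - x| ≤ r → |ρ y t - ρ x t| ≤ ε := by
  have hC : (0 : ℝ) ≤ C := C.coe_nonneg
  obtain ⟨κ, hκ, hgap⟩ := exists_entropyVar_gap α hε (by positivity : (0 : ℝ) < C + 1)
  -- With this `δ` and the radius `δ * κ / 2`, both terms of the oscillation bound are at most `κ /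
  -- 4`, below the gap `κ`.
  set δ := κ / (2 * (C + 1)) with hδ
  have hδ0 : 0 < δ := by positivity
  refine ⟨δ * κ / 2, by positivity, fun t ht x y hxy => ?_⟩
  have hbT := hb (t + 1) (by linarith)
  -- A fixed shift preserves null sets, so for almost every `x` the density is positive at both `x`
  -- and `x + d` when `α ≤ 1 / 2`; continuity then reaches every `x`.
  obtain ⟨d, rfl⟩ : ∃ d, y = x + d := ⟨y - x, by ring⟩
  rw [add_sub_cancel_left] at hxy
  refine forall_le_of_ae_le (f := fun t => |ρ (x + d) t - ρ x t|) isOpen_Ioo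
    ((hbT.continuousOn_time _).sub (hbT.continuousOn_time _)).abs ?_ t ⟨ht, by linarith⟩
  have hpos : ∀ᵐ t ∂timeMeasure (t + 1), ∀ᵐ x, α ≤ 1 / 2 → 0 < ρ x t := by
    by_cases h : α ≤ 1 / 2
    · exact (ae_time_of_ae_slab ((hsol (t + 1) (by linarith)).pos h)).mono
        fun s hs => hs.mono fun x hx _ => hx
    · exact ae_of_all _ fun s => ae_of_all _ fun x hx => absurd hx h
  filter_upwards [hpos, hbT.ae_energy hγ hρbar, ae_timeMeasure_mem _]
    with s hs ⟨_, G, hG, hG2⟩ hsT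
  have hcont := hbT.continuous_space hsT
  refine forall_le_of_ae_le (f := fun x => |ρ (x + d) s - ρ x s|) isOpen_univ
    (by fun_prop) ?_ x (mem_univ x)
  rw [Measure.restrict_univ]
  have hs' : ∀ᵐ x, α ≤ 1 / 2 → 0 < ρ (x + d) s :=
    (measurePreserving_add_right volume d).quasiMeasurePreserving.ae hs
  filter_upwards [hs, hs'] with z hz hz'
  by_contra! hlt
  have hmem : ∀ p, ρ p s ∈ Icc (0 : ℝ) (C + 1) := fun p =>
    ⟨hbT.nonneg p s hsT, (hbT.density_le hρbar hsT p).trans (by linarith)⟩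
  have h1 := hgap _ (hmem (z + d)) _ (hmem z) hz' hz hlt.le
  have hc : ∀ p, (α ≤ 1 / 2 → 0 < ρ p s) → ContinuousAt (fun x => entropyVar α (ρ x s)) p :=
    fun p hp => ContinuousAt.comp (f := fun x => ρ x s) (continuousAt_entropyVar hp)
      hcont.continuousAt
  have h2 := hG.abs_sub_le hC hδ0 hG2 (hc z hz) (hc _ hz')
  rw [add_sub_cancel_left] at h2
  have h3 : δ / 2 * C ≤ κ / 4 := by
    rw [hδ, div_div, div_mul_eq_mul_div, div_le_div_iff₀ (by positivity) (by positivity)]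
    nlinarith
  have h4 : |d| / (2 * δ) ≤ κ / 4 := by
    rw [div_le_iff₀ (by positivity)]
    linarith
  linarith

/-- The local averages of the density are Lipschitz in time, uniformly in space. -/
theorem exists_time_lipschitz (hγ : 1 < γ) (hρbar : 0 ≤ ρbar)
    (hsol : ∀ T : ℝ, 0 < T → IsWeakSolution α γ ρbar ρ0 m0 T ρ u)
    (hb : ∀ T : ℝ, 0 < T → EntropyBounds α γ ρbar C T ρ u)
    {b : ℝ → ℝ} (hbC : ContDiff ℝ ∞ b) (hbs : HasCompactSupport b) :
    ∃ K : ℝ, 0 < K ∧ ∀ t₁ t₂, 0 < t₁ → t₁ ≤ t₂ → ∀ x₀,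
      |(∫ x, ρ x t₂ * b (x - x₀)) - ∫ x, ρ x t₁ * b (x - x₀)| ≤ K * (t₂ - t₁) := by
  have hC : (0 : ℝ) ≤ C := C.coe_nonneg
  have hb'c : Continuous (deriv b) := hbC.continuous_deriv (by simp)
  have hb's : HasCompactSupport fun x => deriv b x ^ 2 :=
    hbs.deriv.comp_left (g := (· ^ 2)) (by simp)
  have hb'i : Integrable fun x => deriv b x ^ 2 :=
    (hb'c.pow 2).integrable_of_hasCompactSupport hb's
  set J := ∫ x, deriv b x ^ 2 with hJ
  have hJ0 : 0 ≤ J := integral_nonneg fun x => sq_nonneg _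
  -- Young's inequality with parameter 1 for `√ρ u` against `√ρ b'`; the final 1 only makes the
  -- constant positive.
  refine ⟨1 / 2 * C + C * J / (2 * 1) + 1, by positivity, fun t₁ t₂ ht₁ ht x₀ => ?_⟩
  have hT : 0 < t₂ + 1 := by linarith
  have hbT := hb _ hT
  -- The cutoff gives compact support in time and equals 1 near `[t₁, t₂]`, so no time derivative
  -- enters.
  let χ : ContDiffBump t₁ := ⟨t₂ - t₁ + 1, t₂ - t₁ + 2, by linarith, by linarith⟩
  let ζ : ℝ × ℝ → ℝ := fun z => b (z.1 - x₀) * χ z.2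
  have hζC : ContDiff ℝ 1 ζ :=
    (hbC.of_le (by simp)).comp (contDiff_fst.sub contDiff_const) |>.mul
      (χ.contDiff.comp contDiff_snd)
  have hbx : HasCompactSupport fun x => b (x - x₀) := hbs.comp_homeomorph (Homeomorph.subRight x₀)
  have hζs : HasCompactSupport ζ := by
    refine HasCompactSupport.intro (K := tsupport (fun x => b (x - x₀)) ×ˢ tsupport χ)
      (hbx.isCompact.prod χ.hasCompactSupport.isCompact) fun z hz => ?_
    rw [mem_prod, not_and_or] at hz
    rcases hz with hz | hz
    · exact mul_eq_zero_of_left (image_eq_zero_of_notMem_tsupport (f := fun x => b (x - x₀)) hz) _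
    · exact mul_eq_zero_of_right _ (image_eq_zero_of_notMem_tsupport hz)
  have hχ : ∀ t, |t - t₁| < t₂ - t₁ + 1 → χ =ᶠ[𝓝 t] fun _ => 1 := fun t h =>
    χ.eventuallyEq_one_of_mem_ball (by simpa [Real.dist_eq] using h)
  have hχ1 : ∀ t, |t - t₁| < t₂ - t₁ + 1 → χ t = 1 := fun t h => (hχ t h).eq_of_nhds
  have hmass := (hsol _ hT).mass t₁ t₂ ht₁.le ht (by linarith) ζ hζC hζs
  have hζv : ∀ x t, |t - t₁| < t₂ - t₁ + 1 → ζ (x, t) = b (x - x₀) := fun x t h => by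
    simp [ζ, hχ1 t h]
  have hζt : ∀ x t, |t - t₁| < t₂ - t₁ + 1 → dt ζ (x, t) = 0 := fun x t h => by
    have : (fun s => ζ (x, s)) =ᶠ[𝓝 t] fun _ => b (x - x₀) :=
      (hχ t h).mono fun s hs => by simp [ζ, hs]
    simp only [dt]
    rw [this.deriv_eq, deriv_const]
  have hζx : ∀ x t, |t - t₁| < t₂ - t₁ + 1 → dx ζ (x, t) = deriv b (x - x₀) := fun x t h => by
    simp only [dx, ζ, hχ1 t h, mul_one]
    exact deriv_comp_sub_const b x₀ x
  simp_rw [hζv _ t₂ (by rw [abs_of_nonneg (by linarith)]; linarith),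
    hζv _ t₁ (by rw [sub_self, abs_zero]; linarith)] at hmass
  rw [hmass, ← Real.norm_eq_abs]
  have hbound : ∀ᵐ t, t ∈ uIoc t₁ t₂ →
      ‖∫ x, (ρ x t * dt ζ (x, t) + ρ x t * u x t * dx ζ (x, t))‖ ≤
        1 / 2 * C + C * J / (2 * 1) := by
    have hE := hbT.ae_energy hγ hρbar
    rw [timeMeasure, ae_restrict_iff' measurableSet_Ioo] at hE
    filter_upwards [hE] with t hE htI
    rw [uIoc_of_le ht] at htI
    have htT : t ∈ Ioo 0 (t₂ + 1) := ⟨ht₁.trans htI.1, by linarith [htI.2]⟩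
    have habs : |t - t₁| < t₂ - t₁ + 1 := by
      rw [abs_of_nonneg (by linarith [htI.1])]
      linarith [htI.2]
    have hcongr : (fun x => ρ x t * dt ζ (x, t) + ρ x t * u x t * dx ζ (x, t)) =
        fun x => (√(ρ x t) * u x t) * (√(ρ x t) * deriv b (x - x₀)) := by
      ext x
      rw [hζt x t habs, hζx x t habs]
      nth_rewrite 2 [← Real.mul_self_sqrt (hbT.nonneg x t htT)]
      ring
    rw [hcongr, Real.norm_eq_abs]
    have hcont := hbT.continuous_space htT
    refine abs_integral_mul_le (f := fun x => √(ρ x t) * u x t) hC (by positivity) one_pos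
      (Continuous.measurable (by fun_prop)) (hE htT).1 ?_
    calc ∫⁻ x, ENNReal.ofReal ((√(ρ x t) * deriv b (x - x₀)) ^ 2)
        ≤ ∫⁻ x, ENNReal.ofReal (C * deriv b (x - x₀) ^ 2) := by
          refine lintegral_mono fun x => ENNReal.ofReal_le_ofReal ?_
          rw [mul_pow, Real.sq_sqrt (hbT.nonneg x t htT)]
          exact mul_le_mul_of_nonneg_right (hbT.density_le hρbar htT x) (sq_nonneg _)
      _ = ENNReal.ofReal (C * J) := by
          rw [← ofReal_integral_eq_lintegral_ofReal ((hb'i.comp_sub_right x₀).const_mul _)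
            (ae_of_all _ fun x => mul_nonneg hC (sq_nonneg _)), integral_const_mul,
            integral_sub_right_eq_self (fun x => deriv b x ^ 2)]
  refine (intervalIntegral.norm_integral_le_of_norm_le_const_ae hbound).trans ?_
  rw [abs_of_nonneg (by linarith)]
  exact mul_le_mul_of_nonneg_right (by linarith) (by linarith)

/-! ### Duration and cost of a deviation -/

/-- A deviation of the density from its far-field value persists for some time. -/
theorem exists_persistence (hγ : 1 < γ) (hρbar : 0 ≤ ρbar)
    (hsol : ∀ T : ℝ, 0 < T → IsWeakSolution α γ ρbar ρ0 m0 T ρ u)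
    (hb : ∀ T : ℝ, 0 < T → EntropyBounds α γ ρbar C T ρ u) (hε : 0 < ε) :
    ∃ τ : ℝ, 0 < τ ∧ ∀ t₀, 0 < t₀ → ∀ x₀, ε < |ρ x₀ t₀ - ρbar| →
      ∀ t ∈ Icc t₀ (t₀ + τ), ∃ x, ε / 4 < |ρ x t - ρbar| := by
  obtain ⟨r, hr, hmod⟩ := exists_space_modulus hγ hρbar hsol hb (by positivity : 0 < ε / 2)
  obtain ⟨b, hbC, hbs, hb0, hb1, hbr⟩ := exists_mollifier hr
  obtain ⟨K, hK, hlip⟩ := exists_time_lipschitz hγ hρbar hsol hb hbC hbs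
  -- During `τ` the average moves by at most `ε / 4`. It starts within `ε / 2` of `ρ x₀ t₀`; if it
  -- also ended within `ε / 4` of `ρbar`, the initial deviation would be at most `ε`.
  refine ⟨ε / 4 / K, by positivity, fun t₀ ht₀ x₀ hx₀ t ht => ?_⟩
  by_contra! H
  have hcont : ∀ s, 0 < s → Continuous fun x => ρ x s := fun s hs =>
    (hb (s + 1) (by linarith)).continuous_space ⟨hs, by linarith⟩
  have h1 := abs_integral_mul_mollifier_sub_le (hcont t₀ ht₀).locallyIntegrable hbC.continuous
    hbs hb0 hb1 hbr (x := x₀) (c := ρ x₀ t₀) fun z hz => hmod t₀ ht₀ x₀ z hz.le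
  have h2 := abs_integral_mul_mollifier_sub_le
    (hcont t (ht₀.trans_le ht.1)).locallyIntegrable hbC.continuous
    hbs hb0 hb1 hbr (x := x₀) (c := ρbar) fun z _ => H z
  have h3 := hlip t₀ t ht₀ ht.1 x₀
  have h4 : K * (t - t₀) ≤ ε / 4 := by
    rw [← le_div_iff₀' hK]
    linarith [ht.2]
  rcases lt_abs.1 hx₀ with h | h <;> rw [abs_le] at h1 h2 h3 <;>
    linarith [h1.1, h1.2, h2.1, h2.2, h3.1, h3.2]

/-- A deviation of the density from its far-field value costs dissipation. -/
theorem exists_dissipation (hs : 0 < (γ + α - 1) / 2) (hρbar : 0 ≤ ρbar)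
    (hb : ∀ T : ℝ, 0 < T → EntropyBounds α γ ρbar C T ρ u) (hε : 0 < ε) :
    ∃ c : ℝ, 0 < c ∧ ∀ T : ℝ, 0 < T → ∃ H : ℝ → ℝ≥0∞, (∫⁻ t in Ioo 0 T, H t) ≤ C ∧
      ∀ᵐ t ∂timeMeasure T, (∃ x, ε < |ρ x t - ρbar|) → ENNReal.ofReal c ≤ H t := by
  obtain ⟨L, hL, hnear⟩ := exists_density_near hρbar hb (by positivity : 0 < ε / 2)
  obtain ⟨κ, hκ, hgap⟩ := exists_rpow_gap hs (by positivity : 0 < ε / 2) C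
  refine ⟨κ ^ 2 / (4 * L), by positivity, fun T hT => ?_⟩
  obtain ⟨g, h, Λ, -, hh, -, -, hbd⟩ := (hb T hT).entropy
  refine ⟨fun t => ∫⁻ x, ENNReal.ofReal (h x t ^ 2), ?_, ?_⟩
  · refine (lintegral_mono fun t => lintegral_mono fun x => ENNReal.ofReal_le_ofReal ?_).trans
      (le_add_self.trans hbd)
    linarith [sq_nonneg (Λ (x, t))]
  · filter_upwards [hnear T hT, hh.2, ae_timeMeasure_mem T] with t hnt hht htT ⟨x, hx⟩
    by_contra! hlt
    obtain ⟨y, hyx, hy⟩ := hnt x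
    have hmem : ∀ p, ρ p t ∈ Icc (0 : ℝ) C := fun p =>
      ⟨(hb T hT).nonneg p t htT, (hb T hT).density_le hρbar htT p⟩
    have hdist : ε / 2 ≤ |ρ y t - ρ x t| := by
      have := abs_sub_le (ρ x t) (ρ y t) ρbar
      rw [abs_sub_comm (ρ x t) (ρ y t)] at this
      linarith
    have h1 := hgap _ (hmem y) _ (hmem x) hdist
    have hcont : Continuous fun x => ρ x t ^ ((γ + α - 1) / 2) :=
      (Real.continuous_rpow_const hs.le).comp ((hb T hT).continuous_space htT)
    -- The parameter `2 * L / κ` balances the two terms at `κ / 4` each, contradicting the gap `κ`.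
    have h2 := hht.abs_sub_le (by positivity) (by positivity : 0 < 2 * L / κ) hlt.le
      hcont.continuousAt (x := x) hcont.continuousAt (y := y)
    have h3 : 2 * L / κ / 2 * (κ ^ 2 / (4 * L)) = κ / 4 := by field_simp
    have h4 : |y - x| / (2 * (2 * L / κ)) ≤ κ / 4 := by
      rw [div_le_iff₀ (by positivity)]
      refine hyx.trans (le_of_eq ?_)
      field_simp
      norm_num
    linarith

end CNS

/-! ### Counting the deviations -/

theorem mainTheorem3 (α γ ρbar : ℝ) (hγ : 1 < γ)
    (hα : (0 < α ∧ α ≤ 1 / 2 ∧ 0 ≤ ρbar) ∨ (1 / 2 < α ∧ 0 < ρbar))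
    (ρ0 m0 : ℝ → ℝ) (hdata : CNS.InitialData α γ ρbar ρ0 m0)
    (ρ u : ℝ → ℝ → ℝ)
    (hsol : ∀ T : ℝ, 0 < T → CNS.IsWeakSolution α γ ρbar ρ0 m0 T ρ u)
    (C : ℝ≥0) (hbounds : ∀ T : ℝ, 0 < T → CNS.EntropyBounds α γ ρbar C T ρ u) :
    Tendsto (fun t : ℝ => ⨆ x : ℝ, ENNReal.ofReal |ρ x t - ρbar|) atTop (𝓝 0) := by
  have hρbar : 0 ≤ ρbar := hα.elim (fun h => h.2.2) fun h => h.2.le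
  have hs : 0 < (γ + α - 1) / 2 := by
    rcases hα with h | h <;> linarith [h.1]
  suffices h : ∀ ε : ℝ, 0 < ε → ∃ t₁ : ℝ, 0 < t₁ ∧ ∀ t, t₁ ≤ t → ∀ x, |ρ x t - ρbar| ≤ ε by
    rw [ENNReal.tendsto_nhds_zero]
    intro ε hε
    obtain ⟨ε', hε', hlt⟩ := ENNReal.lt_iff_exists_nnreal_btwn.1 hε
    obtain ⟨t₁, -, ht₁⟩ := h ε' (by simpa using hε')
    filter_upwards [eventually_ge_atTop t₁] with t ht
    refine (iSup_le fun x => ?_).trans hlt.le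
    rw [← ENNReal.ofReal_coe_nnreal]
    exact ENNReal.ofReal_le_ofReal (ht₁ t ht x)
  intro ε hε
  by_contra! hcon
  obtain ⟨τ, hτ, hpers⟩ := CNS.exists_persistence hγ hρbar hsol hbounds hε
  obtain ⟨c, hc, hdiss⟩ := CNS.exists_dissipation hs hρbar hbounds (by positivity : 0 < ε / 4)
  -- The union of `N` disjoint windows of length `τ`; each new one starts at or after `T`, beyond
  -- all the earlier ones, which lie in `(0, T)`.
  have hsets : ∀ N : ℕ, ∃ T : ℝ, 0 < T ∧ ∃ S : Set ℝ, MeasurableSet S ∧ S ⊆ Ioo 0 T ∧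
      (∀ t ∈ S, ∃ x, ε / 4 < |ρ x t - ρbar|) ∧ volume S = N * ENNReal.ofReal τ := by
    intro N
    induction N with
    | zero => exact ⟨1, one_pos, ∅, MeasurableSet.empty, empty_subset _, by simp, by simp⟩
    | succ N ih =>
      obtain ⟨T, hT, S, hSm, hST, hSbad, hSvol⟩ := ih
      obtain ⟨t₀, ht₀, x₀, hx₀⟩ := hcon T hT
      have ht₀' : 0 < t₀ := hT.trans_le ht₀
      refine ⟨t₀ + τ + 1, by positivity, S ∪ Icc t₀ (t₀ + τ), hSm.union measurableSet_Icc,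
        union_subset (fun t ht => ⟨(hST ht).1, ?_⟩) (fun t ht => ⟨?_, ?_⟩), ?_, ?_⟩
      · linarith [(hST ht).2]
      · linarith [ht.1]
      · linarith [ht.2]
      · rintro t (ht | ht)
        · exact hSbad t ht
        · exact hpers t₀ ht₀' x₀ hx₀ t ht
      · have hdisj : Disjoint S (Icc t₀ (t₀ + τ)) := disjoint_left.2 fun t ht ht' => by
          linarith [(hST ht).2, ht'.1]
        rw [measure_union hdisj measurableSet_Icc, hSvol, Real.volume_Icc, add_sub_cancel_left]
        push_cast
        ring
  obtain ⟨N, hN⟩ := exists_nat_gt (C / (c * τ) : ℝ)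
  obtain ⟨T, hT, S, hSm, hST, hSbad, hSvol⟩ := hsets N
  obtain ⟨H, hH, hHc⟩ := hdiss T hT
  have hle : ENNReal.ofReal (c * (N * τ)) ≤ ENNReal.ofReal C := by
    calc ENNReal.ofReal (c * (N * τ)) = ∫⁻ _ in S, ENNReal.ofReal c := by
          rw [lintegral_const, Measure.restrict_apply MeasurableSet.univ, univ_inter, hSvol,
            ENNReal.ofReal_mul hc.le, ENNReal.ofReal_mul (by positivity), ENNReal.ofReal_natCast]
      _ ≤ ∫⁻ t in S, H t := by
          refine lintegral_mono_ae ?_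
          filter_upwards [ae_restrict_of_ae_restrict_of_subset hST hHc, ae_restrict_mem hSm]
            with t ht htS
          exact ht (hSbad t htS)
      _ ≤ ∫⁻ t in Ioo 0 T, H t := lintegral_mono_set hST
      _ ≤ ENNReal.ofReal C := by rwa [ENNReal.ofReal_coe_nnreal]
  rw [ENNReal.ofReal_le_ofReal_iff C.coe_nonneg] at hle
  rw [div_lt_iff₀ (by positivity)] at hN
  linarith
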